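/- **Setting.** Let $d,M,k$ be natural numbers with $M\ge 1$ and $k\ge 2$. A task is a pair $(X,y)$ with $X\in\mathbb R^{n\times d}$, $y\in\mathbb R^{n}$ (where $n$ may depend on the task); its loss is $\mathcal L(w;(X,y))=\tfrac12\|Xw-y\|^2$. For tasks $(X_m,y_m)$, $m=1,\dots,M$, write $\mathcal L(w;m)$ for the loss of the $m$-th task, let $\mathcal L(w)=\frac1M\sum_{m=1}^M\mathcal L(w;m)$ be the average loss, and let $R=\max_m\|X_m\|_2$ (spectral norm). The tasks are jointly realizable if there is an offline solution $w_\star\in\mathbb R^d$, i.e. $X_mw_\star=y_m$ for all $m$. In a random with-replacement ordering, $\tau_1,\dots,\tau_k$ are independent and uniform on $\{1,\dots,M\}$. Fix an initialization $w_0\in\mathbb R^d$. Scheme 1 (regularized continual regression, coefficients $\lambda_1,\dots,\lambda_k$): for $t=1,\dots,k$, $$w_t\in\operatorname*{arg\,min}_{w}\Big\{\tfrac12\|X_{\tau_t}w-y_{\tau_t}\|^2+\tfrac{\lambda_t}{2}\|w-w_{t-1}\|^2\Big\}.$$ Scheme 2 (finite step budgets, step sizes $\gamma_t$, step counts $N_t\in\mathbb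 N$): for $t=1,\dots,k$, $w_t$ is obtained from $w_{t-1}$ by $N_t$ gradient descent steps of size $\gamma_t$ on $w\mapsto\tfrac12\|X_{\tau_t}w-y_{\tau_t}\|^2$. **Theorem (optimal rates for increasing regularization).** Let the tasks be jointly realizable with offline solution $w_\star$, in a random with-replacement ordering $\tau$. Assume either (i) Scheme 1 is run with $\displaystyle\lambda_t=\frac{13R^2}{3}\cdot\frac{k+1}{k-t+2}$ for $t=1,\dots,k$; or (ii) Scheme 2 is run with deterministic step sizes $\gamma_t>0$ with $\gamma_tR^2<1$ and step counts $\displaystyle N_t=\frac{3}{13\gamma_tR^2}\cdot\frac{k-t+2}{k+1}$ for $t=1,\dots,k$, where the $\gamma_t$ are such that these values are integers (if $R=0$, read $N_t=0$). Then $\mathcal L(w_k)$ is integrable and $$\mathbb E_\tau\,\mathcal L(w_k)\le\frac{20\,\|w_0-w_\star\|^2R^2}{k+1}.$$ This matches the $\Omega(1/k)$ lower bound: there is a universal constant $c>0$ such that for all $d\ge2$, $k\ge2$ and every (possibly randomized) algorithm $\mathcal A$ that receives $k$ tasks and outputs a point of $\mathbb R^d$, there are a point $w_\star$ with $\|w_\star\|\le1$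 and $M=k$ tasks with $R\le1$ and offline solution $w_\star$ such that, if $\tau_1,\dots,\tau_k$ are independent and uniform on $\{1,\dots,k\}$, independently of the internal randomness of $\mathcal A$, then $$\mathbb E_{\tau,\mathcal A}\,\mathcal L\big(\mathcal A\big((X_{\tau_1},y_{\tau_1}),\dots,(X_{\tau_k},y_{\tau_k})\big)\big)\ge\frac ck .$$ -/

import Mathlib

open MeasureTheory ProbabilityTheory

noncomputable section

namespace ContinualRegression

/-- A linear regression task `(X, y)` over `ℝ^d`: a data matrix `X ∈ ℝ^{n × d}` and a label vector
`y ∈ ℝ^n`. The number `n` of samples may differ from task to task. -/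
structure RegressionTask (d : ℕ) where
  n : ℕ
  X : Matrix (Fin n) (Fin d) ℝ
  y : EuclideanSpace ℝ (Fin n)

namespace RegressionTask

variable {d : ℕ}

/-- The matrix-vector product `X w`, as a vector of Euclidean space. -/
def predict (T : RegressionTask d) (w : EuclideanSpace ℝ (Fin d)) : EuclideanSpace ℝ (Fin T.n) :=
  Matrix.toEuclideanLin T.X w

/-- The loss of a single task, `½ ‖X w - y‖²`. -/
def loss (T : RegressionTask d) (w : EuclideanSpace ℝ (Fin d)) : ℝ :=
  (1 / 2) * ‖T.predict w - T.y‖ ^ 2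

/-- The spectral norm of the data matrix. -/
def specNorm (T : RegressionTask d) : ℝ :=
  ‖(Matrix.toEuclideanLin T.X).toContinuousLinearMap‖

/-- One gradient step of size `γ` on the (unregularized) loss of the task. -/
def gradStep (T : RegressionTask d) (γ : ℝ) (v : EuclideanSpace ℝ (Fin d)) : EuclideanSpace ℝ (Fin d) :=
  v - γ • gradient T.loss v

end RegressionTask

variable {d M k : ℕ}

/-- The average loss `(1/M) ∑ₘ ½ ‖Xₘ w - yₘ‖²` over all tasks of the collection. -/
def avgLoss (T : Fin M → RegressionTask d) (w : EuclideanSpace ℝ (Fin d)) : ℝ :=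
  (1 / (M : ℝ)) * ∑ m, (T m).loss w

/-- The data radius `R = maxₘ ‖Xₘ‖₂` (a supremum over the finite set of tasks). -/
def radius (T : Fin M → RegressionTask d) : ℝ :=
  ⨆ m, (T m).specNorm

/-- `w⋆` is an offline solution: `Xₘ w⋆ = yₘ` for every task. The collection is jointly realizable
if there is such a `w⋆`. -/
def IsOfflineSolution (T : Fin M → RegressionTask d) (wStar : EuclideanSpace ℝ (Fin d)) : Prop :=
  ∀ m, (T m).predict wStar = (T m).y

/-- `w₀, …, w_k` are iterates of regularized continual linear regression. The index `i : Fin k`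
stands for the iteration `t = i + 1`, so `w i.castSucc` is `w_{t-1}` and `w i.succ` is `w_t`, which
minimizes `½ ‖X w - y‖² + (λ_t / 2) ‖w - w_{t-1}‖²` for the task `τ_t`. -/
structure IsRegularizedRun (T : Fin M → RegressionTask d) (τ : Fin k → Fin M) (lam : Fin k → ℝ)
    (w₀ : EuclideanSpace ℝ (Fin d)) (w : Fin (k + 1) → EuclideanSpace ℝ (Fin d)) : Prop where
  init : w 0 = w₀
  step : ∀ i : Fin k, IsMinOn
    (fun v => (T (τ i)).loss v + lam i / 2 * ‖v - w i.castSucc‖ ^ 2) Set.univ (w i.succ)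

/-- `w₀, …, w_k` are the iterates of continual linear regression with finite step budgets: in
iteration `t = i + 1`, one does `N_t` gradient steps of size `γ_t` on the loss of the task `τ_t`,
starting at `w_{t-1}`. -/
structure IsBudgetedRun (T : Fin M → RegressionTask d) (τ : Fin k → Fin M) (γ : Fin k → ℝ) (N : Fin k → ℕ)
    (w₀ : EuclideanSpace ℝ (Fin d)) (w : Fin (k + 1) → EuclideanSpace ℝ (Fin d)) : Prop where
  init : w 0 = w₀
  step : ∀ i : Fin k, w i.succ = ((T (τ i)).gradStep (γ i))^[N i] (w i.castSucc)

/-- A random with-replacement task ordering: `τ₁, …, τ_k` are independent and uniform on the `M`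
tasks. -/
structure IsWithReplacement {Ω : Type*} [MeasurableSpace Ω] (P : Measure Ω)
    (τ : Fin k → Ω → Fin M) : Prop where
  measurable : ∀ i, Measurable (τ i)
  indep : iIndepFun τ P
  uniform : ∀ i m, P {ω | τ i ω = m} = (M : ENNReal)⁻¹

end ContinualRegression

end

open ContinualRegression

namespace ContinualRegression

/-! ### One step of either scheme -/

section Step

variable {E F : Type*} [NormedAddCommGroup E] [InnerProductSpace ℝ E]
  [NormedAddCommGroup F] [InnerProductSpace ℝ F]

/-! Upper bounds. Both schemes obey one inequality. A step of effective size `h` (`1/λ`, resp. `Nγ`)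
on task `m` sends `w` to `w'` with `‖w' - u‖² ≤ ‖w - u‖² + 2h (ℓₘ(u) - (1 - hR²) ℓₘ(w))` for every
`u` (`prox_step_bound`, `gd_iterate_bound`). The loss is taken at the old iterate, which does not
depend on the task being drawn, so averaging over orderings turns `ℓₘ` into the average loss, as for
SGD (`sum_loss_drawn_task`). Both schedules amount to the linear decay `hₜ = 3/(13R²) ·
(k+1-t)/(k+1)`, with `t` counted from 0.

To reach the last iterate and not just an average, `u` is a moving point `zₜ₊₁`, a convex
combination of `w⋆` and `w₀, …, wₜ` with weights given by an increasing sequence `σ`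
(`referencePoints`). Passing from `zₜ` to `zₜ₊₁` shrinks the distance to `wₜ` by exactly `σₜ/σₜ₊₁`,
and convexity controls the loss at `zₜ₊₁`. Hence a potential `σₜ² Dₜ + 2 Gₜ σₜ bₜ` (squared distance
to `zₜ` and loss at `zₜ`, averaged) never increases (`potential_telescope`). It starts at `σ₀² ‖w₀ -
w⋆‖²` because `w⋆` has loss 0, and one virtual step after the end extracts the loss of `w_k`
(`last_iterate_of_recursion`).

Lower bound. One task prescribes a coordinate to be `±1`, the other `k - 1` are blank. With
probability `(1 - 1/k)^k ≥ 1/4` the informative task is never drawn; the output law is then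
independent of the sign, and one sign costs at least `1/2` on that task. -/

theorem norm_add_smul_sub_sq_le (a b : F) {p : ℝ} (hp : 0 ≤ p) (hp' : p ≤ 1) :
    ‖(1 - p) • a + p • b‖ ^ 2 ≤ (1 - p) * ‖a‖ ^ 2 + p * ‖b‖ ^ 2 := by
  have h1 : ‖(1 - p) • a + p • b‖ ^ 2
      = (1 - p) * ‖a‖ ^ 2 + p * ‖b‖ ^ 2 - (1 - p) * p * ‖a - b‖ ^ 2 := by
    rw [norm_add_sq_real, norm_sub_sq_real, norm_smul, norm_smul, real_inner_smul_left,
      real_inner_smul_right, mul_pow, mul_pow, Real.norm_eq_abs, Real.norm_eq_abs, sq_abs, sq_abs]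
    ring
  have h2 : 0 ≤ (1 - p) * p * ‖a - b‖ ^ 2 :=
    mul_nonneg (mul_nonneg (by linarith) hp) (sq_nonneg _)
  linarith

/-- Expanding the quadratic objective around its minimizer gives a bound with the residual at `w'`.
The term `lam * ‖w' - w‖²`, usually discarded, pays for moving that residual back to `w`. -/
theorem prox_step_bound (L : E →L[ℝ] F) (y : F) {R lam : ℝ} (hR : ‖L‖ ≤ R) (hlam : 0 < lam)
    {w w' : E}
    (hmin : ∀ v, 1 / 2 * ‖L w' - y‖ ^ 2 + lam / 2 * ‖w' - w‖ ^ 2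
      ≤ 1 / 2 * ‖L v - y‖ ^ 2 + lam / 2 * ‖v - w‖ ^ 2) (u : E) :
    ‖w' - u‖ ^ 2 ≤ ‖w - u‖ ^ 2
      + lam⁻¹ * (‖L u - y‖ ^ 2 - (1 - lam⁻¹ * R ^ 2) * ‖L w - y‖ ^ 2) := by
  have hR0 : 0 ≤ R := (norm_nonneg _).trans hR
  -- first-order optimality
  have hopt : inner ℝ (L w' - y) (L (u - w')) + lam * inner ℝ (w' - w) (u - w') = 0 := by
    set B := inner ℝ (L w' - y) (L (u - w')) + lam * inner ℝ (w' - w) (u - w') with hB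
    set Q := 1 / 2 * ‖L (u - w')‖ ^ 2 + lam / 2 * ‖u - w'‖ ^ 2 with hQ
    -- Along the segment towards `u` the objective exceeds its minimum by this quadratic in `s`; its
    -- constant term is 0, so its discriminant is `B²`.
    have hq : ∀ s : ℝ, 0 ≤ Q * (s * s) + B * s + 0 := by
      intro s
      have h := hmin (w' + s • (u - w'))
      have e1 : L (w' + s • (u - w')) - y = (L w' - y) + s • L (u - w') := by
        rw [map_add, map_smul]; abel
      have e2 : w' + s • (u - w') - w = (w' - w) + s • (u - w') := by abel
      rw [e1, e2, norm_add_sq_real, norm_add_sq_real, norm_smul, norm_smul, real_inner_smul_right,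
        real_inner_smul_right, mul_pow, mul_pow, Real.norm_eq_abs, sq_abs] at h
      rw [hQ, hB]
      nlinarith
    have := discrim_le_zero hq
    rw [discrim] at this
    have h2 : B ^ 2 ≤ 0 := by linarith
    exact pow_eq_zero_iff (two_ne_zero) |>.1 (le_antisymm h2 (sq_nonneg _))
  have e1 : ‖L u - y‖ ^ 2 = ‖L w' - y‖ ^ 2 + 2 * inner ℝ (L w' - y) (L (u - w'))
      + ‖L (u - w')‖ ^ 2 := by
    rw [← norm_add_sq_real, map_sub]; congr 2; abel
  have e2 : ‖w - u‖ ^ 2 = ‖w' - w‖ ^ 2 + 2 * inner ℝ (w' - w) (u - w') + ‖w' - u‖ ^ 2 := by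
    rw [norm_sub_rev w' u, ← norm_add_sq_real, norm_sub_rev w u]; congr 2; abel
  have htri : ‖L w - y‖ ≤ ‖L w' - y‖ + R * ‖w' - w‖ := by
    calc ‖L w - y‖ = ‖(L w' - y) - L (w' - w)‖ := by rw [map_sub]; congr 1; abel
      _ ≤ ‖L w' - y‖ + ‖L (w' - w)‖ := norm_sub_le _ _
      _ ≤ _ := by gcongr; exact L.le_of_opNorm_le hR _
  obtain ⟨h, hh⟩ : ∃ h, lam⁻¹ = h := ⟨_, rfl⟩
  have hh0 : 0 < h := by rw [← hh]; positivity
  have hl : lam * h = 1 := by rw [← hh]; exact mul_inv_cancel₀ hlam.ne'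
  rw [hh]
  set p := ‖L w' - y‖
  set q := ‖w' - w‖
  have hsq : (1 - h * R ^ 2) * ‖L w - y‖ ^ 2 ≤ p ^ 2 + lam * q ^ 2 := by
    by_cases hc : 0 ≤ 1 - h * R ^ 2
    · have h1 : ‖L w - y‖ ^ 2 ≤ (p + R * q) ^ 2 := by gcongr
      -- Weighted Cauchy–Schwarz; afterwards `(1 - hR²)(1 + hR²) ≤ 1`.
      have h2 : (p + R * q) ^ 2 ≤ (1 + h * R ^ 2) * (p ^ 2 + lam * q ^ 2) := by
        have h3 : (1 + h * R ^ 2) * (p ^ 2 + lam * q ^ 2) - (p + R * q) ^ 2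
            = lam * (h * R * p - q) ^ 2 := by
          linear_combination (R ^ 2 * q ^ 2 - p ^ 2 * R ^ 2 * h + 2 * p * q * R) * hl
        nlinarith [mul_nonneg hlam.le (sq_nonneg (h * R * p - q))]
      have h4 : 0 ≤ p ^ 2 + lam * q ^ 2 := by positivity
      calc (1 - h * R ^ 2) * ‖L w - y‖ ^ 2
          ≤ (1 - h * R ^ 2) * ((1 + h * R ^ 2) * (p ^ 2 + lam * q ^ 2)) := by
            gcongr; exact h1.trans h2
        _ = (p ^ 2 + lam * q ^ 2) - (h * R ^ 2) ^ 2 * (p ^ 2 + lam * q ^ 2) := by ring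
        _ ≤ _ := by
          have := mul_nonneg (sq_nonneg (h * R ^ 2)) h4
          linarith
    · have h1 : (1 - h * R ^ 2) * ‖L w - y‖ ^ 2 ≤ 0 :=
        mul_nonpos_of_nonpos_of_nonneg (by linarith) (sq_nonneg _)
      have : 0 ≤ p ^ 2 + lam * q ^ 2 := by positivity
      linarith
  have h5 : h * ((1 - h * R ^ 2) * ‖L w - y‖ ^ 2) ≤ h * (p ^ 2 + lam * q ^ 2) := by gcongr
  have h6 : 0 ≤ h * ‖L (u - w')‖ ^ 2 := by positivity
  rw [e1, e2]
  have h7 : h * (inner ℝ (L w' - y) (L (u - w'))) + inner ℝ (w' - w) (u - w') = 0 := by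
    linear_combination h * hopt - inner ℝ (w' - w) (u - w') * hl
  have h8 : h * (lam * q ^ 2) = q ^ 2 := by linear_combination q ^ 2 * hl
  linarith

variable [CompleteSpace E] [CompleteSpace F]

theorem gradient_sq_loss (L : E →L[ℝ] F) (y : F) (w : E) :
    gradient (fun v => 1 / 2 * ‖L v - y‖ ^ 2) w = L.adjoint (L w - y) := by
  refine HasGradientAt.gradient ?_
  rw [hasGradientAt_iff_hasFDerivAt]
  have h1 : HasFDerivAt (fun v => L v - y) L w := L.hasFDerivAt.sub_const y
  have h2 := (h1.norm_sq).const_mul (1 / 2)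
  have e : (InnerProductSpace.toDual ℝ E) (L.adjoint (L w - y))
      = (1 / 2 : ℝ) • 2 • (innerSL ℝ) (L w - y) ∘SL L := by
    ext v
    simp [ContinuousLinearMap.adjoint_inner_left]
  rw [e]
  exact h2

theorem gd_step_bound (L : E →L[ℝ] F) (y : F) {R γ : ℝ} (hR : ‖L‖ ≤ R) (hγ : 0 ≤ γ) (w u : E) :
    ‖w - γ • L.adjoint (L w - y) - u‖ ^ 2 ≤ ‖w - u‖ ^ 2
      + γ * (‖L u - y‖ ^ 2 - (1 - γ * R ^ 2) * ‖L w - y‖ ^ 2) := by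
  have hg : ‖L.adjoint (L w - y)‖ ^ 2 ≤ R ^ 2 * ‖L w - y‖ ^ 2 := by
    rw [← mul_pow]
    gcongr
    exact ContinuousLinearMap.le_of_opNorm_le _ (by simpa using hR) _
  have e1 : ‖w - γ • L.adjoint (L w - y) - u‖ ^ 2 = ‖w - u‖ ^ 2
      - 2 * γ * inner ℝ (L w - y) (L w - L u) + γ ^ 2 * ‖L.adjoint (L w - y)‖ ^ 2 := by
    rw [sub_right_comm, norm_sub_sq_real, real_inner_smul_right, real_inner_comm,
      ContinuousLinearMap.adjoint_inner_left, norm_smul, mul_pow, Real.norm_eq_abs, sq_abs, map_sub]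
    ring
  have e2 : ‖L u - y‖ ^ 2 = ‖L w - y‖ ^ 2 - 2 * inner ℝ (L w - y) (L w - L u)
      + ‖L w - L u‖ ^ 2 := by
    rw [← norm_sub_sq_real]; congr 2; abel
  rw [e1, e2]
  have h1 : γ ^ 2 * ‖L.adjoint (L w - y)‖ ^ 2 ≤ γ ^ 2 * (R ^ 2 * ‖L w - y‖ ^ 2) := by gcongr
  have h2 : 0 ≤ γ * ‖L w - L u‖ ^ 2 := by positivity
  nlinarith

theorem gd_residual_lower (L : E →L[ℝ] F) (y : F) {R γ : ℝ} (hR : ‖L‖ ≤ R) (hγ : 0 ≤ γ) (w : E) :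
    (1 - γ * R ^ 2) * ‖L w - y‖ ≤ ‖L (w - γ • L.adjoint (L w - y)) - y‖ := by
  have hR0 : 0 ≤ R := (norm_nonneg _).trans hR
  have h1 : ‖L (L.adjoint (L w - y))‖ ≤ R * (R * ‖L w - y‖) :=
    (L.le_of_opNorm_le hR _).trans (by
      gcongr
      exact ContinuousLinearMap.le_of_opNorm_le _ (by simpa using hR) _)
  have e : L (w - γ • L.adjoint (L w - y)) - y
      = (L w - y) - γ • L (L.adjoint (L w - y)) := by
    rw [map_sub, map_smul]; abel
  have h2 := norm_sub_norm_le (L w - y) (γ • L (L.adjoint (L w - y)))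
  rw [norm_smul, Real.norm_of_nonneg hγ] at h2
  rw [e]
  have h3 : γ * ‖L (L.adjoint (L w - y))‖ ≤ γ * (R * (R * ‖L w - y‖)) := by gcongr
  nlinarith

theorem gd_iterate_residual_lower (L : E →L[ℝ] F) (y : F) {R γ : ℝ} (hR : ‖L‖ ≤ R) (hγ : 0 ≤ γ)
    (hγR : γ * R ^ 2 ≤ 1) (w : E) (N : ℕ) :
    (1 - γ * R ^ 2) ^ N * ‖L w - y‖
      ≤ ‖L ((fun v => v - γ • L.adjoint (L v - y))^[N] w) - y‖ := by
  induction N with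
  | zero => simp
  | succ N ih =>
    rw [Function.iterate_succ_apply', pow_succ', mul_assoc]
    exact (mul_le_mul_of_nonneg_left ih (by linarith)).trans (gd_residual_lower L y hR hγ _)

/-- `N` steps of size `γ` act like one step of size `N * γ`. Residuals shrink by at most `1 - γR²`
per step, so Bernoulli bounds the gain of step `N + 1` below by `1 - (2N+1)γR²` times the initial
squared residual, and the odd numbers add up to `N²`. -/
theorem gd_iterate_bound (L : E →L[ℝ] F) (y : F) {R γ : ℝ} (hR : ‖L‖ ≤ R) (hγ : 0 ≤ γ)
    (hγR : γ * R ^ 2 ≤ 1) (w u : E) (N : ℕ) :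
    ‖(fun v => v - γ • L.adjoint (L v - y))^[N] w - u‖ ^ 2 ≤ ‖w - u‖ ^ 2
      + N * γ * (‖L u - y‖ ^ 2 - (1 - N * γ * R ^ 2) * ‖L w - y‖ ^ 2) := by
  induction N with
  | zero => simp
  | succ N ih =>
    rw [Function.iterate_succ_apply']
    set v := (fun v => v - γ • L.adjoint (L v - y))^[N] w
    have h1 := gd_step_bound L y hR hγ v u
    have h2 := gd_iterate_residual_lower L y hR hγ hγR w N
    have hq : 0 ≤ 1 - γ * R ^ 2 := by linarith
    have h3 : (1 - γ * R ^ 2) ^ (2 * N) * ‖L w - y‖ ^ 2 ≤ ‖L v - y‖ ^ 2 := by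
      have := pow_le_pow_left₀ (by positivity) h2 2
      rwa [mul_pow, ← pow_mul, mul_comm N 2] at this
    have h4 : (1 - (2 * N + 1) * (γ * R ^ 2)) * ‖L w - y‖ ^ 2
        ≤ (1 - γ * R ^ 2) * ‖L v - y‖ ^ 2 := by
      have hb := one_add_mul_le_pow (a := -(γ * R ^ 2)) (by linarith) (2 * N + 1)
      push_cast at hb
      calc (1 - (2 * N + 1) * (γ * R ^ 2)) * ‖L w - y‖ ^ 2
          ≤ (1 - γ * R ^ 2) ^ (2 * N + 1) * ‖L w - y‖ ^ 2 := by
            gcongr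
            rw [sub_eq_add_neg 1 (γ * R ^ 2)]; linarith
        _ = (1 - γ * R ^ 2) * ((1 - γ * R ^ 2) ^ (2 * N) * ‖L w - y‖ ^ 2) := by ring
        _ ≤ _ := by gcongr
    have h5 := mul_le_mul_of_nonneg_left h4 hγ
    push_cast
    nlinarith

end Step

/-! ### Averaging over task orderings -/

section Orderings

variable {k M : ℕ}

/-- Resampling: swapping `f t` with an independent task `m` is an involution on pairs `(m, f)`. -/
theorem sum_orderings_decouple (t : Fin k) (φ : Fin M → (Fin k → Fin M) → ℝ)
    (hφ : ∀ m f m', φ m (Function.update f t m') = φ m f) :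
    (M : ℝ) * ∑ f, φ (f t) f = ∑ f, ∑ m, φ m f := by
  let e : Function.Involutive
      (fun p : Fin M × (Fin k → Fin M) => (p.2 t, Function.update p.2 t p.1)) := by
    rintro ⟨m, f⟩
    simp
  have h1 : ∑ p : Fin M × (Fin k → Fin M), φ p.1 p.2
      = ∑ p : Fin M × (Fin k → Fin M), φ (p.2 t) p.2 := by
    rw [← Equiv.sum_comp e.toPerm]
    simp [Function.Involutive.toPerm, hφ]
  rw [Fintype.sum_prod_type, Fintype.sum_prod_type] at h1
  rw [Finset.sum_comm, h1]
  simp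

theorem IsWithReplacement.measure_preimage_singleton {Ω : Type*} [MeasurableSpace Ω]
    {P : Measure Ω} {τ : Fin k → Ω → Fin M} (hτ : IsWithReplacement P τ) (f : Fin k → Fin M) :
    P ((fun ω i => τ i ω) ⁻¹' {f}) = ((M : ENNReal)⁻¹) ^ k := by
  have h := hτ.indep.measure_inter_preimage_eq_mul Finset.univ (sets := fun i => {f i})
    (fun i _ => measurableSet_singleton _)
  have e : (fun ω i => τ i ω) ⁻¹' {f} = ⋂ i ∈ (Finset.univ : Finset (Fin k)), τ i ⁻¹' {f i} := by
    ext ω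
    simp [funext_iff]
  rw [e, h]
  have : ∀ i, P (τ i ⁻¹' {f i}) = (M : ENNReal)⁻¹ := fun i => hτ.uniform i (f i)
  simp [this]

theorem IsWithReplacement.measurable_tuple {Ω : Type*} [MeasurableSpace Ω]
    {P : Measure Ω} {τ : Fin k → Ω → Fin M} (hτ : IsWithReplacement P τ) :
    Measurable (fun ω i => τ i ω) :=
  measurable_pi_iff.2 hτ.measurable

theorem IsWithReplacement.integrable_comp {Ω : Type*} [MeasurableSpace Ω]
    {P : Measure Ω} [IsProbabilityMeasure P] {τ : Fin k → Ω → Fin M} (hτ : IsWithReplacement P τ)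
    (F : (Fin k → Fin M) → ℝ) : Integrable (fun ω => F (fun i => τ i ω)) P :=
  Integrable.comp_measurable (f := fun ω i => τ i ω) (g := F) .of_finite hτ.measurable_tuple

theorem IsWithReplacement.integral_comp {Ω : Type*} [MeasurableSpace Ω]
    {P : Measure Ω} [IsProbabilityMeasure P] {τ : Fin k → Ω → Fin M} (hτ : IsWithReplacement P τ)
    (F : (Fin k → Fin M) → ℝ) :
    ∫ ω, F (fun i => τ i ω) ∂P = ((M : ℝ)⁻¹) ^ k * ∑ f, F f := by
  have : IsProbabilityMeasure (P.map (fun ω i => τ i ω)) :=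
    Measure.isProbabilityMeasure_map hτ.measurable_tuple.aemeasurable
  have h1 := integral_map (μ := P) hτ.measurable_tuple.aemeasurable (f := F)
    (Measurable.of_discrete.aestronglyMeasurable)
  rw [← h1, integral_fintype .of_finite, Finset.mul_sum]
  refine Finset.sum_congr rfl fun f _ => ?_
  rw [Measure.real, Measure.map_apply hτ.measurable_tuple (measurableSet_singleton _),
    hτ.measure_preimage_singleton]
  simp

theorem IsWithReplacement.pos {Ω : Type*} [MeasurableSpace Ω]
    {P : Measure Ω} [IsProbabilityMeasure P] {τ : Fin k → Ω → Fin M} (_ : IsWithReplacement P τ)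
    (i : Fin k) : 0 < M := by
  obtain ⟨ω⟩ := nonempty_of_isProbabilityMeasure P
  exact (τ i ω).pos

end Orderings

/-! ### The weighted potential argument -/

/-- `G` is the remaining sum of `σ (s + 1) * h s`, so the drop of `G` cancels the term in `b (t +
1)`; `hc` then makes the coefficient of `a t` nonpositive. -/
theorem potential_telescope {D b a σ h c G : ℕ → ℝ} {n : ℕ}
    (hG : ∀ t < n, G t = σ (t + 1) * h t + G (t + 1))
    (hG0 : ∀ t ≤ n, 0 ≤ G t)
    (hD : ∀ t < n, σ (t + 1) ^ 2 * D (t + 1)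
      ≤ σ t ^ 2 * D t + 2 * σ (t + 1) ^ 2 * h t * (b (t + 1) - c t * a t))
    (hb : ∀ t < n, σ (t + 1) * b (t + 1) ≤ σ t * b t + (σ (t + 1) - σ t) * a t)
    (ha : ∀ t, 0 ≤ a t)
    (hc : ∀ t < n, G t * (σ (t + 1) - σ t) ≤ h t * c t * σ (t + 1) ^ 2) :
    σ n ^ 2 * D n + 2 * G n * (σ n * b n) ≤ σ 0 ^ 2 * D 0 + 2 * G 0 * (σ 0 * b 0) := by
  have key : ∀ t ≤ n, σ t ^ 2 * D t + 2 * G t * (σ t * b t)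
      ≤ σ 0 ^ 2 * D 0 + 2 * G 0 * (σ 0 * b 0) := by
    intro t
    induction t with
    | zero => intro _; rfl
    | succ t ih =>
      intro ht
      refine le_trans ?_ (ih (by omega))
      have h1 := hD t ht
      have h2 := mul_le_mul_of_nonneg_left (hb t ht) (hG0 t (by omega))
      have h3 := mul_le_mul_of_nonneg_right (hc t ht) (ha t)
      have h4 := hG t ht
      have e : G (t + 1) = G t - σ (t + 1) * h t := by linarith
      rw [e]
      nlinarith
  exact key n le_rfl

/-- The part `1 / (k + 2 - t)` of `σ` is the last-iterate weighting; the shift `1 / (2(k + 1))`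
makes room for the loss factor `1 - h t * ρ`. `hDk` is the virtual step after `k`, where only
nonnegativity is left. -/
theorem last_iterate_of_recursion {D b a : ℕ → ℝ} {k : ℕ} {ρ : ℝ} (hρ : 0 < ρ)
    (σ h : ℕ → ℝ)
    (hσ : ∀ t, σ t = 1 / ((k : ℝ) + 2 - t) + 1 / (2 * ((k : ℝ) + 1)))
    (hh : ∀ t, h t = 3 / (13 * ρ) * (((k : ℝ) + 1 - t) / ((k : ℝ) + 1)))
    (hD : ∀ t < k, σ (t + 1) ^ 2 * D (t + 1)
      ≤ σ t ^ 2 * D t + 2 * σ (t + 1) ^ 2 * h t * (b (t + 1) - (1 - h t * ρ) * a t))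
    (hDk : 0 ≤ σ k ^ 2 * D k + 2 * σ (k + 1) ^ 2 * h k * (b (k + 1) - (1 - h k * ρ) * a k))
    (hb : ∀ t ≤ k, σ (t + 1) * b (t + 1) ≤ σ t * b t + (σ (t + 1) - σ t) * a t)
    (ha : ∀ t, 0 ≤ a t) (hb0 : b 0 = 0) (hD0 : 0 ≤ D 0) :
    a k ≤ 20 * D 0 * ρ / ((k : ℝ) + 1) := by
  obtain ⟨n, hn⟩ : ∃ n : ℝ, n = (k : ℝ) + 1 := ⟨_, rfl⟩
  have hn1 : 1 ≤ n := by rw [hn]; linarith [(Nat.cast_nonneg k : (0 : ℝ) ≤ k)]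
  have hn0 : 0 < n := by linarith
  have hj : ∀ t : ℕ, t ≤ k → 1 ≤ n - t ∧ n - t ≤ n := by
    intro t ht
    have : (t : ℝ) ≤ k := by exact_mod_cast ht
    have h0 : (0 : ℝ) ≤ t := Nat.cast_nonneg t
    constructor <;> linarith
  have hσ' : ∀ t : ℕ, σ t = 1 / (n - t + 1) + 1 / (2 * n) := by
    intro t; rw [hσ, hn]; congr 2; ring
  have hσs : ∀ t : ℕ, σ (t + 1) = 1 / (n - t) + 1 / (2 * n) := by
    intro t; rw [hσ']; push_cast; congr 2; ring
  have hh' : ∀ t : ℕ, h t = 3 / (13 * ρ) * ((n - t) / n) := by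
    intro t; rw [hh, hn]
  -- Closed form of the tail sum; it vanishes at `t = k + 1`.
  set G : ℕ → ℝ := fun t => 3 / (13 * ρ * n) * ((n - t) + (n - t) * (n - t + 1) / (4 * n)) with hGdef
  -- the coefficient inequality, with the exact slack `1 / (j + 1)`
  have hcoef : ∀ t : ℕ, t ≤ k → G t * (σ (t + 1) - σ t) + 3 / (13 * ρ * n) * (1 / ((n - t) * (n - t + 1)))
      ≤ h t * (1 - h t * ρ) * σ (t + 1) ^ 2 := by
    intro t ht
    obtain ⟨h1, h2⟩ := hj t ht
    rw [hσs, hσ', hh']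
    simp only [hGdef]
    set j := n - (t : ℝ)
    have hj0 : 0 < j := by linarith
    have e1 : 3 / (13 * ρ * n) * (j + j * (j + 1) / (4 * n))
        * (1 / j + 1 / (2 * n) - (1 / (j + 1) + 1 / (2 * n))) + 3 / (13 * ρ * n) * (1 / (j * (j + 1)))
        = 3 / (13 * ρ * n) / j * (1 + (j / n) / 4) := by
      field_simp
      ring
    have e2 : 3 / (13 * ρ) * (j / n) * (1 - 3 / (13 * ρ) * (j / n) * ρ) * (1 / j + 1 / (2 * n)) ^ 2
        = 3 / (13 * ρ * n) / j * ((1 - 3 / 13 * (j / n)) * (1 + (j / n) / 2) ^ 2) := by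
      field_simp
    -- With `x = j / n ∈ [0, 1]` what remains is `1 + x/4 ≤ (1 - 3x/13)(1 + x/2)²`.
    rw [e1, e2]
    refine mul_le_mul_of_nonneg_left ?_ (by positivity)
    obtain ⟨x, hx⟩ : ∃ x, x = j / n := ⟨_, rfl⟩
    have hx0 : 0 ≤ x := by rw [hx]; positivity
    have hx1 : x ≤ 1 := by rw [hx, div_le_one hn0]; exact h2
    rw [← hx]
    nlinarith [mul_nonneg hx0 hx0, mul_nonneg hx0 (sub_nonneg.2 hx1),
      mul_nonneg (mul_nonneg hx0 hx0) (sub_nonneg.2 hx1)]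
  have hGpos : ∀ t : ℕ, t ≤ k → 0 ≤ G t := by
    intro t ht
    obtain ⟨h1, h2⟩ := hj t ht
    simp only [hGdef]
    have : 0 ≤ n - (t : ℝ) := by linarith
    positivity
  have hGrec : ∀ t : ℕ, t ≤ k → G t = σ (t + 1) * h t + G (t + 1) := by
    intro t ht
    obtain ⟨h1, h2⟩ := hj t ht
    rw [hσs, hh']
    simp only [hGdef]
    push_cast
    have e : n - ((t : ℝ) + 1) = (n - t) - 1 := by ring
    rw [e]
    set j := n - (t : ℝ)
    have hj0 : 0 < j := by linarith
    field_simp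
    ring
  have hσpos : ∀ t ≤ k, 0 < σ t := by
    intro t ht
    obtain ⟨h1, h2⟩ := hj t ht
    rw [hσ']
    have : 0 < n - (t : ℝ) := by linarith
    positivity
  have hpot := potential_telescope (D := D) (b := b) (a := a) (σ := σ) (h := h)
    (c := fun t => 1 - h t * ρ) (G := G) (n := k) (fun t ht => hGrec t ht.le) hGpos hD
    (fun t ht => hb t ht.le) ha (fun t ht => by
      have h1 := hcoef t ht.le
      obtain ⟨h2, h3⟩ := hj t ht.le
      have : 0 ≤ n - (t : ℝ) := by linarith
      have h4 : 0 ≤ 3 / (13 * ρ * n) * (1 / ((n - t) * (n - t + 1))) := by positivity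
      linarith)
  rw [hb0] at hpot
  have hlast := hcoef k le_rfl
  have hGk : G k = σ (k + 1) * h k := by
    rw [hGrec k le_rfl]
    simp only [hGdef]
    push_cast
    rw [hn]
    simp
  have hbk := mul_le_mul_of_nonneg_left (hb k le_rfl) (hGpos k le_rfl)
  have h1 := mul_le_mul_of_nonneg_right hlast (ha k)
  have h2 : 2 * σ (k + 1) ^ 2 * h k * b (k + 1) = 2 * (G k * (σ (k + 1) * b (k + 1))) := by
    rw [hGk]; ring
  have e3 : n - (k : ℝ) = 1 := by rw [hn]; ring
  rw [e3] at h1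
  -- At `t = k` the slack of `hcoef` is half of `3 / (13ρn)`, and it enters the potential twice.
  have h3 : 3 / (13 * ρ * n) * a k ≤ σ 0 ^ 2 * D 0 := by
    nlinarith
  -- This gives the constant `(13/3) · (9/4) = 39/4`, below the 20 that is claimed.
  have hσ0 : σ 0 ≤ 3 / 2 / n := by
    rw [hσ']
    have : 1 / (n - ((0 : ℕ) : ℝ) + 1) ≤ 1 / n := by
      apply one_div_le_one_div_of_le hn0
      push_cast; linarith
    calc _ ≤ 1 / n + 1 / (2 * n) := by linarith
      _ = _ := by field_simp; norm_num
  have h4 : σ 0 ^ 2 * D 0 ≤ (3 / 2 / n) ^ 2 * D 0 := by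
    have := hσpos 0 (Nat.zero_le _)
    gcongr
  have h5 : a k = (13 * ρ * n / 3) * (3 / (13 * ρ * n) * a k) := by field_simp
  rw [← hn, h5]
  calc (13 * ρ * n / 3) * (3 / (13 * ρ * n) * a k) ≤ (13 * ρ * n / 3) * ((3 / 2 / n) ^ 2 * D 0) := by
        exact mul_le_mul_of_nonneg_left (h3.trans h4) (by positivity)
    _ = 39 / 4 * D 0 * ρ / n := by field_simp; ring
    _ ≤ _ := by
      gcongr
      norm_num

/-! ### Losses of regression tasks -/

namespace RegressionTask

variable {d : ℕ}

/-- The linear map `w ↦ X w` of a task. -/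
noncomputable def lin (T : RegressionTask d) :
    EuclideanSpace ℝ (Fin d) →L[ℝ] EuclideanSpace ℝ (Fin T.n) :=
  (Matrix.toEuclideanLin T.X).toContinuousLinearMap

theorem predict_eq_lin (T : RegressionTask d) (w : EuclideanSpace ℝ (Fin d)) :
    T.predict w = T.lin w := rfl

theorem loss_eq_lin (T : RegressionTask d) :
    T.loss = fun w => 1 / 2 * ‖T.lin w - T.y‖ ^ 2 := rfl

theorem loss_nonneg (T : RegressionTask d) (w : EuclideanSpace ℝ (Fin d)) : 0 ≤ T.loss w := by
  rw [loss_eq_lin]; positivity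

theorem continuous_loss (T : RegressionTask d) : Continuous T.loss := by
  rw [loss_eq_lin]; fun_prop

theorem gradStep_eq (T : RegressionTask d) (γ : ℝ) :
    T.gradStep γ = fun v => v - γ • T.lin.adjoint (T.lin v - T.y) := by
  funext v
  rw [gradStep, loss_eq_lin, gradient_sq_loss]

theorem loss_convex_combination (T : RegressionTask d) (a b : EuclideanSpace ℝ (Fin d)) {p : ℝ}
    (hp : 0 ≤ p) (hp' : p ≤ 1) :
    T.loss ((1 - p) • a + p • b) ≤ (1 - p) * T.loss a + p * T.loss b := by
  have e : T.lin ((1 - p) • a + p • b) - T.y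
      = (1 - p) • (T.lin a - T.y) + p • (T.lin b - T.y) := by
    rw [map_add, map_smul, map_smul]; module
  simp only [loss_eq_lin, e]
  linarith [norm_add_smul_sub_sq_le (T.lin a - T.y) (T.lin b - T.y) hp hp']

theorem exists_prox (T : RegressionTask d) {lam : ℝ} (hlam : 0 < lam)
    (w : EuclideanSpace ℝ (Fin d)) :
    ∃ w', IsMinOn (fun v => T.loss v + lam / 2 * ‖v - w‖ ^ 2) Set.univ w' := by
  have hc : Continuous (fun v => T.loss v + lam / 2 * ‖v - w‖ ^ 2) := by
    have := T.continuous_loss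
    fun_prop
  have hlim : Filter.Tendsto (fun v => T.loss v + lam / 2 * ‖v - w‖ ^ 2)
      (Filter.cocompact (EuclideanSpace ℝ (Fin d))) Filter.atTop := by
    have h1 : Filter.Tendsto (fun v => ‖v - w‖) (Filter.cocompact (EuclideanSpace ℝ (Fin d)))
        Filter.atTop :=
      tendsto_norm_cocompact_atTop.comp
        (Homeomorph.subRight w).isClosedEmbedding.tendsto_cocompact
    have h2 := ((Filter.tendsto_pow_atTop (two_ne_zero)).comp h1).const_mul_atTop
      (show 0 < lam / 2 by positivity)
    refine Filter.tendsto_atTop_mono (fun v => ?_) h2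
    have := T.loss_nonneg v
    simp only [Function.comp_apply]
    linarith
  obtain ⟨x, hx⟩ := hc.exists_forall_le hlim
  exact ⟨x, fun v _ => hx v⟩

/-- The minimizer of the regularized loss of the task. -/
noncomputable def prox (T : RegressionTask d) (lam : ℝ) (hlam : 0 < lam)
    (w : EuclideanSpace ℝ (Fin d)) : EuclideanSpace ℝ (Fin d) :=
  (T.exists_prox hlam w).choose

theorem prox_bound_of_isMinOn (T : RegressionTask d) {lam R : ℝ} (hlam : 0 < lam)
    (hR : T.specNorm ≤ R) {w w' : EuclideanSpace ℝ (Fin d)}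
    (h : IsMinOn (fun v => T.loss v + lam / 2 * ‖v - w‖ ^ 2) Set.univ w')
    (u : EuclideanSpace ℝ (Fin d)) :
    ‖w' - u‖ ^ 2 ≤ ‖w - u‖ ^ 2 + 2 * lam⁻¹ * (T.loss u - (1 - lam⁻¹ * R ^ 2) * T.loss w) := by
  have := prox_step_bound T.lin T.y hR hlam (w := w) (w' := w') (fun v => h (Set.mem_univ v)) u
  simp only [loss_eq_lin]
  linarith

/-- The regularized loss is strictly convex, so its minimizer is unique. -/
theorem prox_unique (T : RegressionTask d) {lam : ℝ} (hlam : 0 < lam)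
    {w w' : EuclideanSpace ℝ (Fin d)}
    (h : IsMinOn (fun v => T.loss v + lam / 2 * ‖v - w‖ ^ 2) Set.univ w') :
    w' = T.prox lam hlam w := by
  obtain ⟨v, hv⟩ : ∃ v, v = T.prox lam hlam w := ⟨_, rfl⟩
  have hmin : IsMinOn (fun v => T.loss v + lam / 2 * ‖v - w‖ ^ 2) Set.univ v := by
    rw [hv]; exact (T.exists_prox hlam w).choose_spec
  rw [← hv]
  -- Comparing both minimizers with their midpoint, the parallelogram law forces `‖w' - v‖ = 0`.
  set m := (1 - (1 / 2 : ℝ)) • w' + (1 / 2 : ℝ) • v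
  have h1 : T.loss m ≤ (1 - 1 / 2) * T.loss w' + 1 / 2 * T.loss v :=
    T.loss_convex_combination w' v (by norm_num) (by norm_num)
  have h2 := h (Set.mem_univ m)
  have h3 := hmin (Set.mem_univ m)
  simp only [Set.mem_ofPred_eq] at h2 h3
  have e : m - w = (1 / 2 : ℝ) • ((w' - w) + (v - w)) := by simp only [m]; module
  have e2 : ‖m - w‖ ^ 2 = 1 / 4 * ‖(w' - w) + (v - w)‖ ^ 2 := by
    rw [e, norm_smul, mul_pow]; norm_num
  have e3 := parallelogram_law_with_norm ℝ (w' - w) (v - w)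
  rw [sub_sub_sub_cancel_right] at e3
  rw [e2] at h2 h3
  have h4 : lam * ‖w' - v‖ ^ 2 ≤ 0 := by
    have e4 := congrArg (lam * ·) e3
    simp only [mul_add] at e4
    linarith
  have h5 : ‖w' - v‖ ^ 2 ≤ 0 := by
    by_contra! hc
    nlinarith [mul_pos hlam hc]
  have h6 : ‖w' - v‖ = 0 := by
    exact pow_eq_zero_iff (two_ne_zero) |>.1 (le_antisymm h5 (sq_nonneg _))
  exact sub_eq_zero.1 (norm_eq_zero.1 h6)

theorem gradStep_iterate_bound (T : RegressionTask d) {γ R : ℝ} (hR : T.specNorm ≤ R)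
    (hγ : 0 ≤ γ) (hγR : γ * R ^ 2 ≤ 1) (N : ℕ) (w u : EuclideanSpace ℝ (Fin d)) :
    ‖(T.gradStep γ)^[N] w - u‖ ^ 2
      ≤ ‖w - u‖ ^ 2 + 2 * (N * γ) * (T.loss u - (1 - N * γ * R ^ 2) * T.loss w) := by
  have := gd_iterate_bound T.lin T.y hR hγ hγR w u N
  rw [gradStep_eq]
  simp only [loss_eq_lin]
  linarith

end RegressionTask

/-! ### Average loss, reference points and the upper bounds -/

section AvgLoss

variable {d M k : ℕ}

theorem specNorm_le_radius (T : Fin M → RegressionTask d) (m : Fin M) :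
    (T m).specNorm ≤ radius T :=
  le_ciSup (f := fun m => (T m).specNorm) (Set.finite_range _).bddAbove m

theorem radius_nonneg (T : Fin M → RegressionTask d) : 0 ≤ radius T :=
  Real.iSup_nonneg fun _ => norm_nonneg _

theorem avgLoss_nonneg (T : Fin M → RegressionTask d) (w : EuclideanSpace ℝ (Fin d)) :
    0 ≤ avgLoss T w := by
  have := Finset.sum_nonneg fun m (_ : m ∈ Finset.univ) => (T m).loss_nonneg w
  rw [avgLoss]; positivity

theorem avgLoss_convex_combination (T : Fin M → RegressionTask d)
    (a b : EuclideanSpace ℝ (Fin d)) {p : ℝ} (hp : 0 ≤ p) (hp' : p ≤ 1) :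
    avgLoss T ((1 - p) • a + p • b) ≤ (1 - p) * avgLoss T a + p * avgLoss T b := by
  have h : ∑ m, (T m).loss ((1 - p) • a + p • b)
      ≤ (1 - p) * ∑ m, (T m).loss a + p * ∑ m, (T m).loss b := by
    rw [Finset.mul_sum, Finset.mul_sum, ← Finset.sum_add_distrib]
    exact Finset.sum_le_sum fun m _ => (T m).loss_convex_combination a b hp hp'
  simp only [avgLoss]
  have := mul_le_mul_of_nonneg_left h (show 0 ≤ 1 / (M : ℝ) by positivity)
  linarith

theorem avgLoss_offline {T : Fin M → RegressionTask d} {wStar : EuclideanSpace ℝ (Fin d)}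
    (h : IsOfflineSolution T wStar) : avgLoss T wStar = 0 := by
  simp [avgLoss, RegressionTask.loss, h _]

theorem avgLoss_of_radius_eq_zero {T : Fin M → RegressionTask d} {wStar : EuclideanSpace ℝ (Fin d)}
    (h : IsOfflineSolution T wStar) (hR : radius T = 0) (w : EuclideanSpace ℝ (Fin d)) :
    avgLoss T w = 0 := by
  have h0 : ∀ m, (T m).lin = 0 := fun m =>
    norm_le_zero_iff.1 ((specNorm_le_radius T m).trans hR.le)
  have h1 : ∀ m, (T m).loss w = 0 := by
    intro m
    rw [RegressionTask.loss, ← h m, RegressionTask.predict_eq_lin, RegressionTask.predict_eq_lin,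
      h0 m]
    simp
  simp [avgLoss, h1]

/-- A point chosen without looking at draw `t` sees a fresh uniform task there. -/
theorem sum_loss_drawn_task (T : Fin M → RegressionTask d) (t : Fin k)
    (g : (Fin k → Fin M) → EuclideanSpace ℝ (Fin d))
    (hg : ∀ f m, g (Function.update f t m) = g f) :
    ∑ f, (T (f t)).loss (g f) = ∑ f, avgLoss T (g f) := by
  have hM : (M : ℝ) ≠ 0 ∨ IsEmpty (Fin k → Fin M) := by
    rcases Nat.eq_zero_or_pos M with rfl | h
    · exact Or.inr ⟨fun f => (f t).elim0⟩
    · exact Or.inl (by exact_mod_cast h.ne')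
  rcases hM with hM | hM
  · have h := sum_orderings_decouple t (fun m f => (T m).loss (g f)) (fun m f m' => by simp [hg])
    simp only [avgLoss]
    rw [← Finset.mul_sum, ← h]
    field_simp
  · simp

/-- The iterates of a scheme whose step `i` sends `w` to `S i m w` if the task `m` is drawn. -/
def iterates {E : Type*} (S : Fin k → Fin M → E → E) (w₀ : E) (f : Fin k → Fin M) : ℕ → E
  | 0 => w₀
  | t + 1 => if h : t < k then S ⟨t, h⟩ (f ⟨t, h⟩) (iterates S w₀ f t) else iterates S w₀ f t

theorem iterates_update {E : Type*} (S : Fin k → Fin M → E → E) (w₀ : E) (f : Fin k → Fin M)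
    (i : Fin k) (m : Fin M) : ∀ t ≤ (i : ℕ),
      iterates S w₀ (Function.update f i m) t = iterates S w₀ f t := by
  intro t
  induction t with
  | zero => intro _; rfl
  | succ t ih =>
    intro ht
    have hne : (⟨t, by omega⟩ : Fin k) ≠ i := by
      intro h; rw [← h] at ht; simp at ht
    have htk : t < k := by omega
    simp only [iterates, htk, dite_true]
    rw [ih (by omega), Function.update_of_ne hne]

theorem eq_iterates {E : Type*} {S : Fin k → Fin M → E → E} {w₀ : E} {f : Fin k → Fin M}
    {w : Fin (k + 1) → E} (h0 : w 0 = w₀) (hs : ∀ i : Fin k, w i.succ = S i (f i) (w i.castSucc))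
    (i : Fin (k + 1)) : w i = iterates S w₀ f i := by
  induction i using Fin.induction with
  | zero => simpa [iterates] using h0
  | succ i ih =>
    rw [hs i, ih]
    simp [iterates]

/-- The reference points of the last-iterate argument: weighted averages of `wStar` and the iterates
before. -/
noncomputable def referencePoints (σ : ℕ → ℝ) (wStar : EuclideanSpace ℝ (Fin d))
    (w : ℕ → EuclideanSpace ℝ (Fin d)) : ℕ → EuclideanSpace ℝ (Fin d)
  | 0 => wStar
  | t + 1 => (1 - (1 - σ t / σ (t + 1))) • referencePoints σ wStar w t
      + (1 - σ t / σ (t + 1)) • w t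

theorem referencePoints_congr (σ : ℕ → ℝ) (wStar : EuclideanSpace ℝ (Fin d))
    {w w' : ℕ → EuclideanSpace ℝ (Fin d)} :
    ∀ t, (∀ s < t, w s = w' s) → referencePoints σ wStar w t = referencePoints σ wStar w' t := by
  intro t
  induction t with
  | zero => intro _; rfl
  | succ t ih =>
    intro h
    simp only [referencePoints]
    rw [ih fun s hs => h s (by omega), h t (by omega)]

theorem norm_sub_referencePoints_succ (σ : ℕ → ℝ) (wStar : EuclideanSpace ℝ (Fin d))
    (w : ℕ → EuclideanSpace ℝ (Fin d)) (t : ℕ) (hσ : 0 < σ (t + 1)) :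
    σ (t + 1) ^ 2 * ‖w t - referencePoints σ wStar w (t + 1)‖ ^ 2
      = σ t ^ 2 * ‖w t - referencePoints σ wStar w t‖ ^ 2 := by
  have e : w t - referencePoints σ wStar w (t + 1)
      = (σ t / σ (t + 1)) • (w t - referencePoints σ wStar w t) := by
    rw [referencePoints]; module
  rw [e, norm_smul, mul_pow, Real.norm_eq_abs, sq_abs]
  field_simp

theorem avgLoss_referencePoints_succ (T : Fin M → RegressionTask d) (σ : ℕ → ℝ)
    (wStar : EuclideanSpace ℝ (Fin d)) (w : ℕ → EuclideanSpace ℝ (Fin d)) (t : ℕ)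
    (h0 : 0 < σ t) (h1 : σ t ≤ σ (t + 1)) :
    σ (t + 1) * avgLoss T (referencePoints σ wStar w (t + 1))
      ≤ σ t * avgLoss T (referencePoints σ wStar w t) + (σ (t + 1) - σ t) * avgLoss T (w t) := by
  have h2 : 0 < σ (t + 1) := h0.trans_le h1
  have hp : σ t / σ (t + 1) ≤ 1 := (div_le_one h2).2 h1
  have hp0 : 0 < σ t / σ (t + 1) := by positivity
  have h := avgLoss_convex_combination T (referencePoints σ wStar w t) (w t)
    (p := 1 - σ t / σ (t + 1)) (by linarith) (by linarith)
  rw [referencePoints]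
  refine (mul_le_mul_of_nonneg_left h h2.le).trans_eq ?_
  field_simp
  ring

theorem sum_avgLoss_last_iterate_le (T : Fin M → RegressionTask d)
    {wStar w₀ : EuclideanSpace ℝ (Fin d)} (hstar : IsOfflineSolution T wStar)
    (hR : 0 < radius T) (hM : 0 < M) (S : Fin k → Fin M → EuclideanSpace ℝ (Fin d) → EuclideanSpace ℝ (Fin d))
    (h : ℕ → ℝ) (hh : ∀ t, h t = 3 / (13 * radius T ^ 2) * (((k : ℝ) + 1 - t) / ((k : ℝ) + 1)))
    (hS : ∀ (i : Fin k) m w u, ‖S i m w - u‖ ^ 2 ≤ ‖w - u‖ ^ 2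
      + 2 * h i * ((T m).loss u - (1 - h i * radius T ^ 2) * (T m).loss w)) :
    ((M : ℝ)⁻¹) ^ k * ∑ f, avgLoss T (iterates S w₀ f k)
      ≤ 20 * ‖w₀ - wStar‖ ^ 2 * radius T ^ 2 / ((k : ℝ) + 1) := by
  obtain ⟨σ, hσ⟩ : ∃ σ : ℕ → ℝ, ∀ t, σ t = 1 / ((k : ℝ) + 2 - t) + 1 / (2 * ((k : ℝ) + 1)) :=
    ⟨_, fun _ => rfl⟩
  have hσpos : ∀ t ≤ k + 1, 0 < σ t := by
    intro t ht
    have : (t : ℝ) ≤ k + 1 := by exact_mod_cast ht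
    have h1 : 0 < (k : ℝ) + 2 - t := by linarith
    rw [hσ]; positivity
  have hσmono : ∀ t ≤ k, σ t ≤ σ (t + 1) := by
    intro t ht
    have : (t : ℝ) ≤ k := by exact_mod_cast ht
    rw [hσ, hσ]
    push_cast
    have : 1 / ((k : ℝ) + 2 - t) ≤ 1 / ((k : ℝ) + 2 - (t + 1)) :=
      one_div_le_one_div_of_le (by linarith) (by linarith)
    linarith
  set W := fun f => iterates S w₀ f with hW
  set Z := fun f => referencePoints σ wStar (W f) with hZ
  set D : ℕ → ℝ := fun t => ∑ f, ‖W f t - Z f t‖ ^ 2 with hD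
  set b : ℕ → ℝ := fun t => ∑ f, avgLoss T (Z f t) with hb
  set a : ℕ → ℝ := fun t => ∑ f, avgLoss T (W f t) with ha
  have hWinv : ∀ (i : Fin k) f m, W (Function.update f i m) i = W f i := fun i f m =>
    iterates_update S w₀ f i m i le_rfl
  -- The reference point `i + 1` uses iterates up to index `i` only, all fixed before draw `i`.
  have hZinv : ∀ (i : Fin k) f m, Z (Function.update f i m) (i + 1) = Z f (i + 1) := fun i f m =>
    referencePoints_congr σ wStar _ fun s hs => iterates_update S w₀ f i m s (by omega)
  have hdist : ∀ t ≤ k, σ (t + 1) ^ 2 * ∑ f, ‖W f t - Z f (t + 1)‖ ^ 2 = σ t ^ 2 * D t := by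
    intro t ht
    simp only [hD, Finset.mul_sum]
    exact Finset.sum_congr rfl fun f _ =>
      norm_sub_referencePoints_succ σ wStar (W f) t (hσpos _ (by omega))
  have main := last_iterate_of_recursion (D := D) (b := b) (a := a) (k := k)
    (ρ := radius T ^ 2) (by positivity) σ h hσ hh ?_ ?_ ?_ ?_ ?_ ?_
  · have hD0 : D 0 = (M : ℝ) ^ k * ‖w₀ - wStar‖ ^ 2 := by
      simp [hD, hW, hZ, iterates, referencePoints]
    rw [hD0] at main
    have hM' : (M : ℝ) ≠ 0 := by exact_mod_cast hM.ne'
    refine (mul_le_mul_of_nonneg_left main (by positivity)).trans_eq ?_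
    rw [inv_pow]
    field_simp
  · intro t ht
    have h1 : D (t + 1) ≤ ∑ f, ‖W f t - Z f (t + 1)‖ ^ 2
        + 2 * h t * (b (t + 1) - (1 - h t * radius T ^ 2) * a t) := by
      have e1 := sum_loss_drawn_task T ⟨t, ht⟩ (fun f => Z f (t + 1)) (hZinv ⟨t, ht⟩)
      have e2 := sum_loss_drawn_task T ⟨t, ht⟩ (fun f => W f t) (hWinv ⟨t, ht⟩)
      simp only [hb, ha]
      rw [← e1, ← e2, Finset.mul_sum, ← Finset.sum_sub_distrib, Finset.mul_sum,
        ← Finset.sum_add_distrib]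
      refine Finset.sum_le_sum fun f _ => ?_
      have e : W f (t + 1) = S ⟨t, ht⟩ (f ⟨t, ht⟩) (W f t) := by simp [hW, iterates, ht]
      rw [e]
      exact hS ⟨t, ht⟩ _ _ _
    have h2 := mul_le_mul_of_nonneg_left h1 (sq_nonneg (σ (t + 1)))
    rw [mul_add, hdist t ht.le] at h2
    linarith
  -- The virtual step: a gradient step of size `h k` from the last iterate, averaged over all tasks.
  -- The squared distance after it is nonnegative.
  · rw [← hdist k le_rfl]
    have hhk : 0 ≤ h k := by
      rw [hh]
      have : (0 : ℝ) ≤ k + 1 - k := by linarith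
      positivity
    have h1 : ∀ w u, 0 ≤ ‖w - u‖ ^ 2
        + 2 * h k * (avgLoss T u - (1 - h k * radius T ^ 2) * avgLoss T w) := by
      intro w u
      have h2 : 0 ≤ ∑ m, (‖w - u‖ ^ 2
          + 2 * h k * ((T m).loss u - (1 - h k * radius T ^ 2) * (T m).loss w)) :=
        Finset.sum_nonneg fun m _ => (sq_nonneg _).trans
          ((gd_step_bound (T m).lin (T m).y (specNorm_le_radius T m) hhk w u).trans_eq (by
            simp only [RegressionTask.loss_eq_lin]; ring))
      have hM' : (M : ℝ) ≠ 0 := by exact_mod_cast hM.ne'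
      rw [Finset.sum_add_distrib, ← Finset.mul_sum, Finset.sum_sub_distrib, ← Finset.mul_sum] at h2
      have h3 := mul_nonneg (show 0 ≤ 1 / (M : ℝ) by positivity) h2
      simp only [Finset.sum_const, Finset.card_univ, Fintype.card_fin, nsmul_eq_mul] at h3
      refine h3.trans_eq ?_
      simp only [avgLoss]
      field_simp
    have h2 : 0 ≤ ∑ f, ‖W f k - Z f (k + 1)‖ ^ 2
        + 2 * h k * (b (k + 1) - (1 - h k * radius T ^ 2) * a k) := by
      simp only [hb, ha]
      rw [Finset.mul_sum, ← Finset.sum_sub_distrib, Finset.mul_sum, ← Finset.sum_add_distrib]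
      exact Finset.sum_nonneg fun f _ => h1 _ _
    have h3 := mul_nonneg (sq_nonneg (σ (k + 1))) h2
    linarith
  · intro t ht
    simp only [hb, ha]
    rw [Finset.mul_sum, Finset.mul_sum, Finset.mul_sum, ← Finset.sum_add_distrib]
    exact Finset.sum_le_sum fun f _ =>
      avgLoss_referencePoints_succ T σ wStar (W f) t (hσpos t (by omega)) (hσmono t ht)
  · exact fun t => Finset.sum_nonneg fun f _ => avgLoss_nonneg T _
  · simp [hb, hZ, referencePoints, avgLoss_offline hstar]
  · exact Finset.sum_nonneg fun f _ => sq_nonneg _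

theorem expected_avgLoss_last_iterate_le (T : Fin M → RegressionTask d)
    {wStar w₀ : EuclideanSpace ℝ (Fin d)} (hstar : IsOfflineSolution T wStar) (hk : 0 < k)
    (hR : 0 < radius T) {Ω : Type*} [MeasurableSpace Ω] {P : Measure Ω} [IsProbabilityMeasure P]
    {τ : Fin k → Ω → Fin M} (hτ : IsWithReplacement P τ)
    (S : Fin k → Fin M → EuclideanSpace ℝ (Fin d) → EuclideanSpace ℝ (Fin d))
    (h : ℕ → ℝ) (hh : ∀ t, h t = 3 / (13 * radius T ^ 2) * (((k : ℝ) + 1 - t) / ((k : ℝ) + 1)))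
    (hS : ∀ (i : Fin k) m w u, ‖S i m w - u‖ ^ 2 ≤ ‖w - u‖ ^ 2
      + 2 * h i * ((T m).loss u - (1 - h i * radius T ^ 2) * (T m).loss w))
    (w : Ω → Fin (k + 1) → EuclideanSpace ℝ (Fin d)) (hw0 : ∀ ω, w ω 0 = w₀)
    (hw : ∀ ω (i : Fin k), w ω i.succ = S i (τ i ω) (w ω i.castSucc)) :
    Integrable (fun ω => avgLoss T (w ω (Fin.last k))) P ∧
      ∫ ω, avgLoss T (w ω (Fin.last k)) ∂P
        ≤ 20 * ‖w₀ - wStar‖ ^ 2 * radius T ^ 2 / ((k : ℝ) + 1) := by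
  -- The last iterate is a function of the ordering alone, which has finitely many values, so
  -- integrability needs no measurability of `w`.
  have e : ∀ ω, w ω (Fin.last k) = iterates S w₀ (fun i => τ i ω) k := fun ω => by
    simpa using eq_iterates (f := fun i => τ i ω) (hw0 ω) (hw ω) (Fin.last k)
  simp only [e]
  refine ⟨hτ.integrable_comp fun f => avgLoss T (iterates S w₀ f k), ?_⟩
  rw [hτ.integral_comp fun f => avgLoss T (iterates S w₀ f k)]
  exact sum_avgLoss_last_iterate_le T hstar hR (hτ.pos ⟨0, hk⟩) S h hh hS

theorem regularized_upper_bound (T : Fin M → RegressionTask d)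
    {wStar w₀ : EuclideanSpace ℝ (Fin d)} (hstar : IsOfflineSolution T wStar) (hk : 0 < k)
    {Ω : Type*} [MeasurableSpace Ω] {P : Measure Ω} [IsProbabilityMeasure P]
    {τ : Fin k → Ω → Fin M} (hτ : IsWithReplacement P τ) {lam : Fin k → ℝ}
    (hlam : ∀ i : Fin k, lam i =
      13 * radius T ^ 2 / 3 * (((k : ℝ) + 1) / ((k : ℝ) - ((i : ℝ) + 1) + 2)))
    (w : Ω → Fin (k + 1) → EuclideanSpace ℝ (Fin d))
    (hw : ∀ ω, IsRegularizedRun T (fun i => τ i ω) lam w₀ (w ω)) :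
    Integrable (fun ω => avgLoss T (w ω (Fin.last k))) P ∧
      ∫ ω, avgLoss T (w ω (Fin.last k)) ∂P
        ≤ 20 * ‖w₀ - wStar‖ ^ 2 * radius T ^ 2 / ((k : ℝ) + 1) := by
  -- If the radius is 0, the coefficients vanish and minimizers need not be unique, but every loss
  -- is identically 0.
  rcases (radius_nonneg T).eq_or_lt with hR | hR
  · simp [avgLoss_of_radius_eq_zero hstar hR.symm, ← hR]
  have hi : ∀ i : Fin k, 0 < (k : ℝ) - ((i : ℝ) + 1) + 2 := fun i => by
    have : (i : ℝ) < k := by exact_mod_cast i.2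
    linarith
  have hpos : ∀ i, 0 < lam i := fun i => by
    have := hi i
    rw [hlam]; positivity
  refine expected_avgLoss_last_iterate_le T hstar hk hR hτ
    (fun i m w => (T m).prox (lam i) (hpos i) w) _ (fun t => rfl) ?_ w (fun ω => (hw ω).init)
    fun ω i => (T (τ i ω)).prox_unique (hpos i) ((hw ω).step i)
  intro i m w u
  have e : 3 / (13 * radius T ^ 2) * (((k : ℝ) + 1 - (i : ℕ)) / ((k : ℝ) + 1)) = (lam i)⁻¹ := by
    have := hi i
    rw [hlam, mul_inv, inv_div, inv_div]
    congr 2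
    ring
  rw [e]
  exact (T m).prox_bound_of_isMinOn (hpos i) (specNorm_le_radius T m)
    ((T m).exists_prox (hpos i) w).choose_spec u

theorem budgeted_upper_bound (T : Fin M → RegressionTask d)
    {wStar w₀ : EuclideanSpace ℝ (Fin d)} (hstar : IsOfflineSolution T wStar) (hk : 0 < k)
    {Ω : Type*} [MeasurableSpace Ω] {P : Measure Ω} [IsProbabilityMeasure P]
    {τ : Fin k → Ω → Fin M} (hτ : IsWithReplacement P τ) {γ : Fin k → ℝ} {N : Fin k → ℕ}
    (hγ : ∀ i, 0 < γ i ∧ γ i * radius T ^ 2 < 1)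
    (hN : ∀ i : Fin k, (N i : ℝ) =
      3 / (13 * γ i * radius T ^ 2) * (((k : ℝ) - ((i : ℝ) + 1) + 2) / ((k : ℝ) + 1)))
    (w : Ω → Fin (k + 1) → EuclideanSpace ℝ (Fin d))
    (hw : ∀ ω, IsBudgetedRun T (fun i => τ i ω) γ N w₀ (w ω)) :
    Integrable (fun ω => avgLoss T (w ω (Fin.last k))) P ∧
      ∫ ω, avgLoss T (w ω (Fin.last k)) ∂P
        ≤ 20 * ‖w₀ - wStar‖ ^ 2 * radius T ^ 2 / ((k : ℝ) + 1) := by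
  rcases (radius_nonneg T).eq_or_lt with hR | hR
  · simp [avgLoss_of_radius_eq_zero hstar hR.symm, ← hR]
  refine expected_avgLoss_last_iterate_le T hstar hk hR hτ
    (fun i m w => ((T m).gradStep (γ i))^[N i] w) _ (fun t => rfl) ?_ w (fun ω => (hw ω).init)
    fun ω i => (hw ω).step i
  intro i m w u
  have e : 3 / (13 * radius T ^ 2) * (((k : ℝ) + 1 - (i : ℕ)) / ((k : ℝ) + 1)) = N i * γ i := by
    have := (hγ i).1
    rw [hN]
    field_simp
    ring
  rw [e]
  exact (T m).gradStep_iterate_bound (specNorm_le_radius T m) (hγ i).1.le (hγ i).2.le _ w u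

end AvgLoss

/-! ### The lower bound -/

section LowerBound

variable {d k : ℕ}

/-- The task with no constraint: one zero row and label `0`. -/
def blankTask (d : ℕ) : RegressionTask d := ⟨1, 0, 0⟩

/-- The task that asks for the coordinate `j` to be `s`. -/
noncomputable def coordTask (j : Fin d) (s : ℝ) : RegressionTask d :=
  ⟨1, Matrix.of fun _ => Pi.single j 1, WithLp.toLp 2 fun _ => s⟩

theorem norm_const_fin_one (a : ℝ) :
    ‖(WithLp.toLp 2 fun _ => a : EuclideanSpace ℝ (Fin 1))‖ = |a| := by
  simp [EuclideanSpace.norm_eq, Real.sqrt_sq_eq_abs]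

theorem coordTask_predict (j : Fin d) (s : ℝ) (w : EuclideanSpace ℝ (Fin d)) :
    (coordTask j s).predict w = (WithLp.toLp 2 fun _ => w j : EuclideanSpace ℝ (Fin 1)) := by
  change Matrix.toEuclideanLin (Matrix.of fun (_ : Fin 1) => (Pi.single j 1 : Fin d → ℝ)) w
    = (WithLp.toLp 2 fun _ => w j : EuclideanSpace ℝ (Fin 1))
  ext i
  simp [Matrix.toLpLin_apply, Matrix.mulVec, Matrix.of_apply]

theorem coordTask_loss (j : Fin d) (s : ℝ) (w : EuclideanSpace ℝ (Fin d)) :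
    (coordTask j s).loss w = 1 / 2 * (w j - s) ^ 2 := by
  rw [RegressionTask.loss, coordTask_predict]
  change 1 / 2 * ‖(WithLp.toLp 2 fun _ => w j - s : EuclideanSpace ℝ (Fin 1))‖ ^ 2 = _
  rw [norm_const_fin_one, sq_abs]

theorem coordTask_specNorm_le (j : Fin d) (s : ℝ) : (coordTask j s).specNorm ≤ 1 := by
  refine ContinuousLinearMap.opNorm_le_bound _ zero_le_one fun w => ?_
  change ‖(coordTask j s).predict w‖ ≤ _
  rw [coordTask_predict, one_mul]
  change ‖(WithLp.toLp 2 fun _ => w j : EuclideanSpace ℝ (Fin 1))‖ ≤ _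
  rw [norm_const_fin_one]
  exact PiLp.norm_apply_le w j

theorem blankTask_predict (w : EuclideanSpace ℝ (Fin d)) : (blankTask d).predict w = 0 := by
  change Matrix.toEuclideanLin (0 : Matrix (Fin 1) (Fin d) ℝ) w = 0
  rw [map_zero, LinearMap.zero_apply]

theorem blankTask_loss (w : EuclideanSpace ℝ (Fin d)) : (blankTask d).loss w = 0 := by
  rw [RegressionTask.loss, blankTask_predict]
  change 1 / 2 * ‖(0 : EuclideanSpace ℝ (Fin 1)) - 0‖ ^ 2 = 0
  simp

theorem blankTask_specNorm_le : (blankTask d).specNorm ≤ 1 := by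
  refine ContinuousLinearMap.opNorm_le_bound _ zero_le_one fun w => ?_
  change ‖(blankTask d).predict w‖ ≤ _
  rw [blankTask_predict, norm_zero]
  positivity

/-- The collection with one coordinate task and otherwise blank tasks. -/
noncomputable def hiddenTask (j : Fin d) (s : ℝ) (i₀ : Fin k) : Fin k → RegressionTask d :=
  fun i => if i = i₀ then coordTask j s else blankTask d

theorem hiddenTask_self (j : Fin d) (s : ℝ) (i₀ : Fin k) :
    hiddenTask j s i₀ i₀ = coordTask j s := if_pos rfl

theorem hiddenTask_of_ne (j : Fin d) (s : ℝ) {i i₀ : Fin k} (h : i ≠ i₀) :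
    hiddenTask j s i₀ i = blankTask d := if_neg h

theorem hiddenTask_isOfflineSolution (j : Fin d) (s : ℝ) (i₀ : Fin k) :
    IsOfflineSolution (hiddenTask j s i₀) (EuclideanSpace.single j s) := by
  intro i
  by_cases h : i = i₀
  · rw [h, hiddenTask_self, coordTask_predict]
    simp [coordTask]
  · rw [hiddenTask_of_ne j s h, blankTask_predict]
    rfl

theorem hiddenTask_radius_le (j : Fin d) (s : ℝ) (i₀ : Fin k) : radius (hiddenTask j s i₀) ≤ 1 := by
  refine Real.iSup_le (fun i => ?_) zero_le_one
  by_cases h : i = i₀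
  · rw [h, hiddenTask_self]
    exact coordTask_specNorm_le j s
  · rw [hiddenTask_of_ne j s h]
    exact blankTask_specNorm_le

theorem hiddenTask_avgLoss (j : Fin d) (s : ℝ) (i₀ : Fin k) (w : EuclideanSpace ℝ (Fin d)) :
    avgLoss (hiddenTask j s i₀) w = 1 / (k : ℝ) * (1 / 2 * (w j - s) ^ 2) := by
  rw [avgLoss, Finset.sum_eq_single_of_mem i₀ (Finset.mem_univ _), hiddenTask_self, coordTask_loss]
  intro i _ h
  rw [hiddenTask_of_ne j s h, blankTask_loss]

/-- The losses for `s = 1` and `s = -1` add up to `(w j)² + 1 ≥ 1`. -/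
theorem exists_sign_lintegral_ge (μ : Measure (EuclideanSpace ℝ (Fin d))) [IsProbabilityMeasure μ]
    (j : Fin d) : ∃ s : ℝ, |s| = 1 ∧
      ENNReal.ofReal (1 / 2) ≤ ∫⁻ w, ENNReal.ofReal (1 / 2 * (w j - s) ^ 2) ∂μ := by
  by_contra! hcon
  have h1 := hcon 1 (by norm_num)
  have h2 := hcon (-1) (by norm_num)
  have hm : ∀ s : ℝ, Measurable
      fun w : EuclideanSpace ℝ (Fin d) => ENNReal.ofReal (1 / 2 * (w j - s) ^ 2) := fun s => by
    fun_prop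
  have h3 := ENNReal.add_lt_add h1 h2
  rw [← lintegral_add_left (hm 1), ← ENNReal.ofReal_add (by norm_num) (by norm_num)] at h3
  refine absurd h3 (not_lt.2 ?_)
  calc ENNReal.ofReal (1 / 2 + 1 / 2) = ∫⁻ _ : EuclideanSpace ℝ (Fin d), 1 ∂μ := by
        norm_num
    _ ≤ _ := by
      refine lintegral_mono fun w => ?_
      simp only
      rw [← ENNReal.ofReal_add (by positivity) (by positivity), ← ENNReal.ofReal_one]
      apply ENNReal.ofReal_le_ofReal
      nlinarith [sq_nonneg (w j)]

theorem one_fourth_le_one_sub_inv_pow (hk : 2 ≤ k) : 1 / 4 ≤ (1 - (k : ℝ)⁻¹) ^ k := by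
  have hk' : (2 : ℝ) ≤ k := by exact_mod_cast hk
  have hinv : (k : ℝ)⁻¹ ≤ 1 / 2 := by
    rw [one_div]; exact inv_anti₀ (by norm_num) hk'
  -- Bernoulli with exponent `k` would only give 0; exponent `k / 2 ≥ 1` gives `1/2`, which is then
  -- squared.
  have h := one_add_mul_self_le_rpow_one_add (s := -(k : ℝ)⁻¹) (by linarith) (p := k / 2)
    (by linarith)
  have e : 1 + (k : ℝ) / 2 * -(k : ℝ)⁻¹ = 1 / 2 := by
    field_simp; norm_num
  rw [e, ← sub_eq_add_neg] at h
  have h2 := pow_le_pow_left₀ (by norm_num) h 2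
  rw [← Real.rpow_mul_natCast (by linarith)] at h2
  have e2 : (k : ℝ) / 2 * ((2 : ℕ) : ℝ) = (k : ℕ) := by push_cast; ring
  rw [e2, Real.rpow_natCast] at h2
  linarith

theorem IsWithReplacement.measure_unseen {Ω : Type*} [MeasurableSpace Ω] {P : Measure Ω}
    [IsProbabilityMeasure P] {τ : Fin k → Ω → Fin k} (hτ : IsWithReplacement P τ) (hk : 2 ≤ k)
    (i₀ : Fin k) : ENNReal.ofReal (1 / 4) ≤ P {ω | ∀ i, τ i ω ≠ i₀} := by
  have h := hτ.indep.measure_inter_preimage_eq_mul Finset.univ (sets := fun _ => {i₀}ᶜ)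
    (fun i _ => (measurableSet_singleton _).compl)
  have e : {ω | ∀ i, τ i ω ≠ i₀} = ⋂ i ∈ (Finset.univ : Finset (Fin k)), τ i ⁻¹' {i₀}ᶜ := by
    ext ω
    simp
  have hk' : (2 : ℝ) ≤ k := by exact_mod_cast hk
  have hinv : (k : ℝ)⁻¹ ≤ 1 / 2 := by
    rw [one_div]; exact inv_anti₀ (by norm_num) hk'
  have h1 : ∀ i, P (τ i ⁻¹' {i₀}ᶜ) = ENNReal.ofReal (1 - (k : ℝ)⁻¹) := by
    intro i
    have hu : P (τ i ⁻¹' {i₀}) = (k : ENNReal)⁻¹ := hτ.uniform i i₀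
    rw [Set.preimage_compl, prob_compl_eq_one_sub (hτ.measurable i (measurableSet_singleton _)), hu,
      ENNReal.ofReal_sub _ (by positivity), ENNReal.ofReal_one,
      ENNReal.ofReal_inv_of_pos (by linarith), ENNReal.ofReal_natCast]
  rw [e, h]
  simp only [h1, Finset.prod_const, Finset.card_univ, Fintype.card_fin]
  rw [← ENNReal.ofReal_pow (by linarith)]
  exact ENNReal.ofReal_le_ofReal (one_fourth_le_one_sub_inv_pow hk)

theorem lower_bound (hd : 0 < d) (hk : 2 ≤ k)
    (A : (Fin k → RegressionTask d) → Measure (EuclideanSpace ℝ (Fin d)))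
    (hA : ∀ S, IsProbabilityMeasure (A S)) :
    ∃ (T : Fin k → RegressionTask d) (wStar : EuclideanSpace ℝ (Fin d)),
      IsOfflineSolution T wStar ∧ ‖wStar‖ ≤ 1 ∧ radius T ≤ 1 ∧
      ∀ (Ω : Type*) [MeasurableSpace Ω] (P : Measure Ω) [IsProbabilityMeasure P]
        (τ : Fin k → Ω → Fin k), IsWithReplacement P τ →
        ENNReal.ofReal (1 / 8 / k) ≤
          ∫⁻ ω, ∫⁻ w, ENNReal.ofReal (avgLoss T w) ∂(A fun i => T (τ i ω)) ∂P := by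
  let j : Fin d := ⟨0, hd⟩
  let i₀ : Fin k := ⟨0, by omega⟩
  have := hA fun _ => blankTask d
  -- The sign is chosen against the output law on all-blank input, the only law that matters when
  -- `i₀` is not drawn.
  obtain ⟨s, hs, hint⟩ := exists_sign_lintegral_ge (A fun _ => blankTask d) j
  refine ⟨hiddenTask j s i₀, EuclideanSpace.single j s, hiddenTask_isOfflineSolution j s i₀,
    by simp [hs], hiddenTask_radius_le j s i₀, ?_⟩
  intro Ω _ P _ τ hτ
  have hmeas : MeasurableSet {ω | ∀ i, τ i ω ≠ i₀} := by
    rw [Set.ofPred_forall]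
    exact MeasurableSet.iInter fun i => hτ.measurable i (measurableSet_singleton i₀).compl
  have hin : ∀ ω ∈ {ω | ∀ i, τ i ω ≠ i₀}, ENNReal.ofReal (1 / k * (1 / 2))
      ≤ ∫⁻ w, ENNReal.ofReal (avgLoss (hiddenTask j s i₀) w)
        ∂(A fun i => hiddenTask j s i₀ (τ i ω)) := by
    intro ω hω
    have e : (fun i => hiddenTask j s i₀ (τ i ω)) = fun _ => blankTask d := by
      funext i
      simp [hiddenTask, hω i]
    rw [e]
    simp only [hiddenTask_avgLoss]
    have hk0 : (0 : ℝ) ≤ 1 / k := by positivity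
    simp only [ENNReal.ofReal_mul hk0]
    rw [lintegral_const_mul _ (by fun_prop)]
    simpa only [ENNReal.ofReal_mul (show (0 : ℝ) ≤ 1 / 2 by norm_num)] using mul_le_mul_right hint _
  calc ENNReal.ofReal (1 / 8 / k) = ENNReal.ofReal (1 / k * (1 / 2)) * ENNReal.ofReal (1 / 4) := by
        rw [← ENNReal.ofReal_mul (by positivity)]; congr 1; ring
    _ ≤ ENNReal.ofReal (1 / k * (1 / 2)) * P {ω | ∀ i, τ i ω ≠ i₀} := by
        gcongr; exact hτ.measure_unseen hk i₀
    _ = ∫⁻ _ in {ω | ∀ i, τ i ω ≠ i₀}, ENNReal.ofReal (1 / k * (1 / 2)) ∂P := by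
        rw [setLIntegral_const]
    _ ≤ ∫⁻ ω in {ω | ∀ i, τ i ω ≠ i₀}, ∫⁻ w, ENNReal.ofReal (avgLoss (hiddenTask j s i₀) w)
        ∂(A fun i => hiddenTask j s i₀ (τ i ω)) ∂P := setLIntegral_mono' hmeas hin
    _ ≤ _ := setLIntegral_le_lintegral _ _

end LowerBound

end ContinualRegression

theorem mainTheorem1 :
    -- The upper bounds
    (∀ (d M k : ℕ), 2 ≤ k →
      ∀ (T : Fin M → RegressionTask d) (wStar : EuclideanSpace ℝ (Fin d)), IsOfflineSolution T wStar →
      ∀ (w₀ : EuclideanSpace ℝ (Fin d))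
        (Ω : Type*) [MeasurableSpace Ω] (P : Measure Ω) [IsProbabilityMeasure P]
        (τ : Fin k → Ω → Fin M), IsWithReplacement P τ →
      -- (i) scheduled coefficient; the iteration is `t = i + 1`
      (∀ lam : Fin k → ℝ,
        (∀ i : Fin k, lam i =
          13 * radius T ^ 2 / 3 * (((k : ℝ) + 1) / ((k : ℝ) - ((i : ℝ) + 1) + 2))) →
        ∀ w : Ω → Fin (k + 1) → EuclideanSpace ℝ (Fin d),
          (∀ ω, IsRegularizedRun T (fun i => τ i ω) lam w₀ (w ω)) →
          Integrable (fun ω => avgLoss T (w ω (Fin.last k))) P ∧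
          ∫ ω, avgLoss T (w ω (Fin.last k)) ∂P ≤
            20 * ‖w₀ - wStar‖ ^ 2 * radius T ^ 2 / ((k : ℝ) + 1)) ∧
      -- (ii) scheduled budget; the iteration is `t = i + 1`
      (∀ (γ : Fin k → ℝ) (N : Fin k → ℕ),
        (∀ i, 0 < γ i ∧ γ i * radius T ^ 2 < 1) →
        (∀ i : Fin k, (N i : ℝ) =
          3 / (13 * γ i * radius T ^ 2) * (((k : ℝ) - ((i : ℝ) + 1) + 2) / ((k : ℝ) + 1))) →
        ∀ w : Ω → Fin (k + 1) → EuclideanSpace ℝ (Fin d),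
          (∀ ω, IsBudgetedRun T (fun i => τ i ω) γ N w₀ (w ω)) →
          Integrable (fun ω => avgLoss T (w ω (Fin.last k))) P ∧
          ∫ ω, avgLoss T (w ω (Fin.last k)) ∂P ≤
            20 * ‖w₀ - wStar‖ ^ 2 * radius T ^ 2 / ((k : ℝ) + 1))) ∧
    -- The matching lower bound: `A` sends the `k` tasks that it sees to the law of its output
    (∃ c : ℝ, 0 < c ∧
      ∀ (d k : ℕ), 2 ≤ d → 2 ≤ k →
      ∀ A : (Fin k → RegressionTask d) → Measure (EuclideanSpace ℝ (Fin d)),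
        (∀ S, IsProbabilityMeasure (A S)) →
      ∃ (T : Fin k → RegressionTask d) (wStar : EuclideanSpace ℝ (Fin d)),
        IsOfflineSolution T wStar ∧ ‖wStar‖ ≤ 1 ∧ radius T ≤ 1 ∧
        ∀ (Ω : Type*) [MeasurableSpace Ω] (P : Measure Ω) [IsProbabilityMeasure P]
          (τ : Fin k → Ω → Fin k), IsWithReplacement P τ →
          ENNReal.ofReal (c / k) ≤
            ∫⁻ ω, ∫⁻ w, ENNReal.ofReal (avgLoss T w) ∂(A fun i => T (τ i ω)) ∂P) := by
  refine ⟨?_, 1 / 8, by norm_num, ?_⟩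
  · intro d M k hk T wStar hstar w₀ Ω _ P _ τ hτ
    exact ⟨fun lam hlam w hw => regularized_upper_bound T hstar (by omega) hτ hlam w hw,
      fun γ N hγ hN w hw => budgeted_upper_bound T hstar (by omega) hτ hγ hN w hw⟩
  · intro d k hd hk A hA
    exact lower_bound (by omega) hk A hA
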